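/- **Setting.** Let $U$ be an ultrafilter on an arbitrary index set $I$; nonstandard extensions ${}^*X$ are ultrapowers modulo $U$, and internal sets, functions, measures and Hilbert spaces are given by ultraproducts modulo $U$. For hyperreals, $r\approx s$ means $|r-s|<\varepsilon$ for every standard real $\varepsilon>0$, and $\operatorname{st}(r)$ is the standard part of a finite hyperreal $r$. For an internal probability measure $\mu$ on an internal algebra of internal sets, the Loeb measure $\mu_L$ is the $\sigma$-additive extension of $A\mapsto\operatorname{st}(\mu(A))$ to the $\sigma$-algebra generated by that algebra. For an internal Hilbert space $\mathbf H$, let $\operatorname{fin}(\mathbf H)$ be the set of vectors of finite norm and $\operatorname{mon}(\mathbf H)$ the set of vectors of infinitesimal norm. The nonstandard hull is the Hilbert space ${}^\circ\mathbf H=\operatorname{fin}(\mathbf H)/\operatorname{mon}(\mathbf H)$ with inner product $\langle{}^\circ\phi|{}^\circ\chi\rangle=\operatorname{st}\langle\phi|\chi\rangle$. If $B$ is an internal operator whose internal operator norm is finite, its hull is the bounded operator ${}^\circ B\,{}^\circ|\phi\rangle={}^\circ(B|\phi\rangle)$ on ${}^\circ\mathbf H$. The scalar-valued spectral measure of a bounded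 self-adjoint operator $T$ at a vector $v$ is the regular Borel measure $\nu$ on $\mathbb R$ with $\int f\,d\nu=\langle v|f(T)v\rangle$ for all $f\in C_c(\mathbb R)$. Let $\alpha,\beta\in\mathbb C$ with $|\alpha|^2+|\beta|^2=1$ and let $K\in{}^*\mathbb N$ be infinite. Let $\mathbf H=\bigotimes_{i=1}^K{}^*\mathbb C^2$ be the internal tensor product of $K$ copies of ${}^*\mathbb C^2$, with its internal orthonormal basis $(|x\rangle)_{x\in 2^K}$, where $2^K$ is the hyperfinite set of internal $0$-$1$ sequences of length $K$. For $x\in 2^K$ let $i_x$ be the internal cardinality of $\{j : x(j)=1\}$ and put $\lambda_x=i_x/K$. Let $$|\psi\rangle=\sum_{x\in 2^K}\alpha^{i_x}\beta^{K-i_x}|x\rangle,\qquad B|x\rangle=\lambda_x|x\rangle .$$ Let $\mu^{|\psi\rangle}$ be the internal probability measure $\mu^{|\psi\rangle}(A)=\sum_{x\in A}|\alpha^{i_x}\beta^{K-i_x}|^2$ on internal subsets $A$ of $2^K$; use the same name for the internal scalar-valued spectral measure $E\mapsto\sum_{\lambda_x\in E}|\alpha^{i_x}\beta^{K-i_x}|^2$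 on internally Borel subsets $E$ of ${}^*\mathbb R$. Let $\mu_L^{|\psi\rangle}$ denote the corresponding Loeb measures, and let $\nu^{{}^\circ|\psi\rangle}$ be the scalar-valued spectral measure of ${}^\circ B$ at ${}^\circ|\psi\rangle$. **Theorem.** The set $\{x\in 2^K:\lambda_x\approx|\alpha|^2\}$ is Loeb measurable and $$\mu_L^{|\psi\rangle}(\{x\in 2^K:\lambda_x\approx|\alpha|^2\})=1 ;$$ likewise, for the Loeb measure on ${}^*\mathbb R$, the set $\{r\in{}^*\mathbb R:r\approx|\alpha|^2\}$ is Loeb measurable and has measure $1$. Moreover $\nu^{{}^\circ|\psi\rangle}(\{|\alpha|^2\})=1$, and ${}^\circ|\psi\rangle$ is an eigenvector of ${}^\circ B$ with eigenvalue $|\alpha|^2$. -/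

import Mathlib

open Filter Topology MeasureTheory
open scoped ENNReal NNReal

noncomputable section

namespace Nonstandard

/-! ### Hyperreal numbers over an arbitrary ultrafilter

The nonstandard extension of a set `X` is its ultrapower modulo a fixed ultrafilter `U` on an
arbitrary index type. -/

/-- The nonstandard extension `*X`. -/
abbrev Hyper {ι : Type*} (U : Ultrafilter ι) (X : Type*) : Type _ := Germ (U : Filter ι) X

section Basics

variable {ι : Type*} {U : Ultrafilter ι}

/-- A hypernatural number is infinite if it exceeds every standard natural number. -/
def IsInfiniteNat (K : Hyper U ℕ) : Prop := ∀ n : ℕ, (Germ.const n : Hyper U ℕ) < K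

/-- A hyperreal number is finite if it is bounded by a standard real number. -/
def IsFinite (r : Hyper U ℝ) : Prop := ∃ C : ℝ, |r| ≤ (Germ.const C : Hyper U ℝ)

/-- `r ≈ s`: the difference is smaller than every positive standard real number. -/
def InfClose (r s : Hyper U ℝ) : Prop :=
  ∀ ε : ℝ, 0 < ε → |r - s| < (Germ.const ε : Hyper U ℝ)

/-- The standard part of a (finite) hyperreal number. -/
def st (r : Hyper U ℝ) : ℝ := ArchimedeanClass.stdPart r

/-- The standard part of a (finite) hypercomplex number. -/
def stC (z : Hyper U ℂ) : ℂ := ⟨st (z.map Complex.re), st (z.map Complex.im)⟩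

/-- The embedding of the reals into the hyperreals. -/
def constHom (U : Ultrafilter ι) : ℝ →+*o Hyper U ℝ where
  toFun r := Germ.const r
  map_zero' := rfl
  map_one' := rfl
  map_add' _ _ := rfl
  map_mul' _ _ := rfl
  monotone' _ _ h := Germ.const_le h

theorem isFinite_coe {f : ι → ℝ} :
    IsFinite (f : Hyper U ℝ) ↔ ∃ C : ℝ, ∀ᶠ i in U, |f i| ≤ C := Iff.rfl

theorem infClose_coe {f g : ι → ℝ} :
    InfClose (f : Hyper U ℝ) (g : Hyper U ℝ) ↔ ∀ ε : ℝ, 0 < ε → ∀ᶠ i in U, |f i - g i| < ε := by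
  refine forall₂_congr fun ε _ => ?_
  exact Germ.coe_lt (φ := U) (f := fun i => |f i - g i|) (g := fun _ => ε)

theorem st_eq_of_tendsto {f : ι → ℝ} {r : ℝ} (h : Tendsto f U (𝓝 r)) :
    st (f : Hyper U ℝ) = r := by
  refine ArchimedeanClass.stdPart_eq (constHom U) (fun s hs => ?_) (fun s hs => ?_)
  · exact (h.eventually (lt_mem_nhds hs)).mono fun _ hi => le_of_lt hi
  · exact (h.eventually (gt_mem_nhds hs)).mono fun _ hi => le_of_lt hi

theorem tendsto_st {f : ι → ℝ} (h : IsFinite (f : Hyper U ℝ)) :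
    Tendsto f U (𝓝 (st (f : Hyper U ℝ))) := by
  obtain ⟨C, hC⟩ := isFinite_coe.1 h
  have hc : IsCompact (Set.Icc (-C) C) := isCompact_Icc
  have hmem : (U.map f : Filter ℝ) ≤ 𝓟 (Set.Icc (-C) C) := by
    rw [le_principal_iff]
    exact hC.mono fun i hi => abs_le.1 hi
  obtain ⟨r, -, hr⟩ := hc.ultrafilter_le_nhds (U.map f) hmem
  have hr2 : Tendsto f U (𝓝 r) := hr
  rwa [st_eq_of_tendsto hr2]

/-- The standard part of a finite hyperreal is the standard real infinitely close to it. -/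
theorem infClose_const_st {r : Hyper U ℝ} (h : IsFinite r) : InfClose r (Germ.const (st r)) := by
  induction r using Germ.inductionOn with
  | h f =>
    refine infClose_coe.2 fun ε hε => ?_
    exact (Metric.tendsto_nhds.1 (tendsto_st h) ε hε).mono fun i hi => by
      simpa [Real.dist_eq] using hi

end Basics

/-! ### Internal sets and Loeb measure -/

/-- The ultraproduct of a family of sets, that is, the internal set determined by it. -/
def UltraProd {ι : Type*} (U : Ultrafilter ι) (X : ι → Type*) : Type _ :=
  Filter.Product (U : Filter ι) X

namespace UltraProd

variable {ι : Type*} {U : Ultrafilter ι} {X : ι → Type*}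

/-- The element of the ultraproduct represented by a family. -/
def mk (U : Ultrafilter ι) (x : ∀ i, X i) : UltraProd U X :=
  Quotient.mk (productSetoid (U : Filter ι) X) x

theorem ind {p : UltraProd U X → Prop} (h : ∀ x : ∀ i, X i, p (mk U x)) (x : UltraProd U X) :
    p x := Quotient.ind h x

theorem mk_eq_mk {x y : ∀ i, X i} : mk U x = mk U y ↔ ∀ᶠ i in U, x i = y i :=
  Quotient.eq (r := productSetoid (U : Filter ι) X)

/-- The internal function with values in `*Y` given by a family of functions. -/
def map {Y : Type*} (f : ∀ i, X i → Y) (x : UltraProd U X) : Hyper U Y :=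
  Quotient.liftOn x (fun x => ((fun i => f i (x i) : ι → Y) : Hyper U Y))
    fun _ _ h => Germ.coe_eq.2 (Eventually.mono h fun i hi => congrArg (f i) hi)

@[simp] theorem map_mk {Y : Type*} (f : ∀ i, X i → Y) (x : ∀ i, X i) :
    map f (mk U x) = ((fun i => f i (x i) : ι → Y) : Hyper U Y) := rfl

/-- The internal set `[A i]` given by a family of sets. -/
def internalSet (U : Ultrafilter ι) (A : ∀ i, Set (X i)) : Set (UltraProd U X) :=
  {x | Quotient.liftOn x (fun x => ∀ᶠ i in U, x i ∈ A i) fun _ _ h => propext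
    ⟨fun hx => hx.mp (h.mono fun _ hi hm => hi ▸ hm),
      fun hx => hx.mp (h.mono fun _ hi hm => hi ▸ hm)⟩}

theorem mk_mem_internalSet {A : ∀ i, Set (X i)} {x : ∀ i, X i} :
    mk U x ∈ internalSet U A ↔ ∀ᶠ i in U, x i ∈ A i := Iff.rfl

theorem internalSet_empty : internalSet U (fun i => (∅ : Set (X i))) = ∅ := by
  ext x
  induction x using ind with
  | h x => simp [mk_mem_internalSet, NeBot.ne]

theorem internalSet_union (A B : ∀ i, Set (X i)) :
    internalSet U (fun i => A i ∪ B i) = internalSet U A ∪ internalSet U B := by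
  ext x
  induction x using ind with
  | h x => simp [mk_mem_internalSet, Ultrafilter.eventually_or]

theorem internalSet_diff (A B : ∀ i, Set (X i)) :
    internalSet U (fun i => A i \ B i) = internalSet U A \ internalSet U B := by
  ext x
  induction x using ind with
  | h x =>
    rw [Set.mem_sdiff, mk_mem_internalSet, mk_mem_internalSet, mk_mem_internalSet,
      ← Ultrafilter.eventually_not, ← eventually_and]
    rfl

/-- The internal algebra of internally measurable internal sets. -/
def internalAlgebra (U : Ultrafilter ι) (X : ι → Type*) [∀ i, MeasurableSpace (X i)] :
    Set (Set (UltraProd U X)) :=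
  {S | ∃ A : ∀ i, Set (X i), (∀ i, MeasurableSet (A i)) ∧ internalSet U A = S}

variable [∀ i, MeasurableSpace (X i)]

/-- The σ-algebra generated by the internal algebra. -/
instance instMeasurableSpace : MeasurableSpace (UltraProd U X) :=
  MeasurableSpace.generateFrom (internalAlgebra U X)

theorem isSetRing_internalAlgebra : IsSetRing (internalAlgebra U X) where
  empty_mem := ⟨fun _ => ∅, fun _ => MeasurableSet.empty, internalSet_empty⟩
  union_mem := by
    rintro _ _ ⟨A, hA, rfl⟩ ⟨B, hB, rfl⟩
    exact ⟨_, fun i => (hA i).union (hB i), internalSet_union A B⟩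
  sdiff_mem := by
    rintro _ _ ⟨A, hA, rfl⟩ ⟨B, hB, rfl⟩
    exact ⟨_, fun i => (hA i).diff (hB i), internalSet_diff A B⟩

variable (P : ∀ i, ProbabilityMeasure (X i))

/-- The internal measure of `[A i]`, a hyperreal number in `*[0,1]`. -/
def internalMeasure (U : Ultrafilter ι) (A : ∀ i, Set (X i)) : Hyper U ℝ :=
  ((fun i => (P i : Measure (X i)).real (A i) : ι → ℝ) : Hyper U ℝ)

theorem tendsto_internalMeasure (A : ∀ i, Set (X i)) :
    Tendsto (fun i => (P i : Measure (X i)).real (A i)) U (𝓝 (st (internalMeasure P U A))) := by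
  refine tendsto_st (isFinite_coe.2 ⟨1, Eventually.of_forall fun i => ?_⟩)
  rw [abs_of_nonneg measureReal_nonneg]
  exact measureReal_le_one

theorem st_internalMeasure_nonneg (A : ∀ i, Set (X i)) : 0 ≤ st (internalMeasure P U A) :=
  ge_of_tendsto (tendsto_internalMeasure P A) (Eventually.of_forall fun _ => measureReal_nonneg)

theorem st_internalMeasure_empty : st (internalMeasure P U fun _ => ∅) = 0 :=
  st_eq_of_tendsto (by simp)

theorem st_internalMeasure_univ : st (internalMeasure P U fun _ => Set.univ) = 1 :=
  st_eq_of_tendsto (by simp)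

/-- The saturation argument behind countable additivity of the Loeb measure. -/
theorem st_internalMeasure_le_tsum (A : ∀ i, Set (X i)) (B : ℕ → ∀ i, Set (X i))
    (hA : ∀ i, MeasurableSet (A i)) (hB : ∀ n i, MeasurableSet (B n i))
    (h : internalSet U A ⊆ ⋃ n, internalSet U (B n)) :
    ENNReal.ofReal (st (internalMeasure P U A)) ≤
      ∑' n, ENNReal.ofReal (st (internalMeasure P U (B n))) := by
  by_contra hlt
  rw [not_le] at hlt
  set s : ℝ := st (internalMeasure P U A) with hs
  set b : ℕ → ℝ := fun n => st (internalMeasure P U (B n)) with hb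
  have hb0 : ∀ n, 0 ≤ b n := fun n => st_internalMeasure_nonneg P (B n)
  have hfin : ∑' n, ENNReal.ofReal (b n) ≠ ∞ := hlt.ne_top
  set t : ℝ := (∑' n, ENNReal.ofReal (b n)).toReal with ht
  have hts : t < s := by
    have h1 := (ENNReal.toReal_lt_toReal hfin ENNReal.ofReal_ne_top).2 hlt
    rwa [ENNReal.toReal_ofReal (st_internalMeasure_nonneg P A)] at h1
  have hpart : ∀ N, ∑ n ∈ Finset.range N, b n ≤ t := by
    intro N
    have h1 : ENNReal.ofReal (∑ n ∈ Finset.range N, b n) ≤ ∑' n, ENNReal.ofReal (b n) := by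
      rw [ENNReal.ofReal_sum_of_nonneg fun n _ => hb0 n]
      exact ENNReal.sum_le_tsum _
    exact (ENNReal.ofReal_le_iff_le_toReal hfin).1 h1
  -- the part of `A i` that is not covered by the first `N` sets
  let D : ℕ → ∀ i, Set (X i) := fun N i => A i \ ⋃ n ∈ Finset.range N, B n i
  have hDm : ∀ N i, MeasurableSet (D N i) := fun N i =>
    (hA i).diff (Finset.measurableSet_biUnion _ fun n _ => hB n i)
  have hDanti : ∀ i, Antitone fun N => D N i := by
    intro i M N hMN x hx
    refine ⟨hx.1, fun hx2 => hx.2 ?_⟩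
    simp only [Set.mem_iUnion, Finset.mem_range] at hx2 ⊢
    obtain ⟨n, hn, hxn⟩ := hx2
    exact ⟨n, lt_of_lt_of_le hn hMN, hxn⟩
  let ε : ℝ := (s - t) / 2
  have hε : 0 < ε := by simp only [ε]; linarith
  have hbig : ∀ N, ∀ᶠ i in U, ε < (P i : Measure (X i)).real (D N i) := by
    intro N
    have hlim : Tendsto (fun i => (P i : Measure (X i)).real (A i) -
        ∑ n ∈ Finset.range N, (P i : Measure (X i)).real (B n i)) U
        (𝓝 (s - ∑ n ∈ Finset.range N, b n)) :=
      (tendsto_internalMeasure P A).sub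
        (tendsto_finsetSum _ fun n _ => tendsto_internalMeasure P (B n))
    have hgt : ε < s - ∑ n ∈ Finset.range N, b n := by
      have := hpart N
      simp only [ε]; linarith
    filter_upwards [hlim.eventually (lt_mem_nhds hgt)] with i hi
    refine hi.trans_le ?_
    have h1 : (P i : Measure (X i)).real (⋃ n ∈ Finset.range N, B n i) ≤
        ∑ n ∈ Finset.range N, (P i : Measure (X i)).real (B n i) :=
      measureReal_biUnion_finset_le _ _
    have h2 := le_measureReal_sdiff (μ := (P i : Measure (X i))) (s₁ := A i)
      (s₂ := ⋃ n ∈ Finset.range N, B n i) (measure_ne_top _ _)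
    linarith
  -- a point of `A i` avoiding as many of the sets as possible
  have hpt : ∀ i, ∃ x : X i, ∀ N, ε < (P i : Measure (X i)).real (D N i) → x ∈ D N i := by
    intro i
    by_cases hall : ∀ N, ε < (P i : Measure (X i)).real (D N i)
    · have hmeas : ENNReal.ofReal ε ≤ (P i : Measure (X i)) (⋂ N, D N i) := by
        have := tendsto_measure_iInter_atTop (μ := (P i : Measure (X i)))
          (fun N => (hDm N i).nullMeasurableSet) (hDanti i) ⟨0, measure_ne_top _ _⟩
        refine ge_of_tendsto this (Eventually.of_forall fun N => ?_)
        exact ENNReal.ofReal_le_of_le_toReal (hall N).le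
      have hne : (⋂ N, D N i).Nonempty := by
        refine nonempty_of_measure_ne_zero (μ := (P i : Measure (X i))) fun h0 => ?_
        rw [h0, nonpos_iff_eq_zero, ENNReal.ofReal_eq_zero] at hmeas
        exact absurd hmeas (not_le.2 hε)
      obtain ⟨x, hx⟩ := hne
      exact ⟨x, fun N _ => Set.mem_iInter.1 hx N⟩
    · push Not at hall
      classical
      obtain ⟨hf, hmin⟩ := And.intro (Nat.find_spec hall) (@Nat.find_min _ _ hall)
      rcases Nat.eq_zero_or_pos (Nat.find hall) with h0 | hpos
      · have : Nonempty (X i) := (P i).nonempty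
        refine ⟨Classical.arbitrary _, fun N hN => ?_⟩
        rw [h0] at hf
        exact absurd (hN.trans_le (measureReal_mono (hDanti i (Nat.zero_le N)))) (not_lt.2 hf)
      · have hM := hmin (Nat.sub_lt hpos one_pos)
        rw [not_le] at hM
        have hne : (D (Nat.find hall - 1) i).Nonempty := by
          by_contra hemp
          rw [Set.not_nonempty_iff_eq_empty] at hemp
          rw [hemp, measureReal_empty] at hM
          exact lt_asymm hε hM
        obtain ⟨x, hx⟩ := hne
        refine ⟨x, fun N hN => hDanti i ?_ hx⟩
        by_contra hlt2
        have hle : Nat.find hall ≤ N := by omega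
        exact absurd (hN.trans_le (measureReal_mono (hDanti i hle))) (not_lt.2 hf)
  choose x hx using hpt
  have hxA : mk U x ∈ internalSet U A :=
    (hbig 0).mono fun i hi => (hx i 0 hi).1
  obtain ⟨n, hn⟩ := Set.mem_iUnion.1 (h hxA)
  rw [mk_mem_internalSet] at hn
  obtain ⟨i, hi1, hi2⟩ := (hn.and (hbig (n + 1))).exists
  refine (hx i (n + 1) hi2).2 ?_
  simp only [Set.mem_iUnion, Finset.mem_range]
  exact ⟨n, Nat.lt_succ_self n, hi1⟩

open Classical in
/-- The finitely additive set function `[A i] ↦ st (μ [A i])` on the internal algebra. -/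
def loebFun (S : Set (UltraProd U X)) : ℝ≥0∞ :=
  if h : S ∈ internalAlgebra U X then ENNReal.ofReal (st (internalMeasure P U h.choose)) else 0

theorem st_internalMeasure_mono {A B : ∀ i, Set (X i)} (hA : ∀ i, MeasurableSet (A i))
    (hB : ∀ i, MeasurableSet (B i)) (h : internalSet U A ⊆ internalSet U B) :
    ENNReal.ofReal (st (internalMeasure P U A)) ≤ ENNReal.ofReal (st (internalMeasure P U B)) := by
  let C : ℕ → ∀ i, Set (X i) := fun n => if n = 0 then B else fun i => ∅
  have hC0 : C 0 = B := rfl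
  have hCs : ∀ n, n ≠ 0 → C n = fun i => ∅ := fun n hn => if_neg hn
  have := st_internalMeasure_le_tsum P A C hA (fun n i => by
    by_cases hn : n = 0
    · subst hn; exact hB i
    · rw [hCs n hn]; exact MeasurableSet.empty) (h.trans (Set.subset_iUnion_of_subset 0 subset_rfl))
  rwa [tsum_eq_single 0 fun n hn => ?_, hC0] at this
  rw [hCs n hn]
  rw [st_internalMeasure_empty, ENNReal.ofReal_zero]

theorem loebFun_internalSet {A : ∀ i, Set (X i)} (hA : ∀ i, MeasurableSet (A i)) :
    loebFun P (internalSet U A) = ENNReal.ofReal (st (internalMeasure P U A)) := by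
  have hmem : internalSet U A ∈ internalAlgebra U X := ⟨A, hA, rfl⟩
  rw [loebFun, dif_pos hmem]
  obtain ⟨h1, h2⟩ := hmem.choose_spec
  exact le_antisymm (st_internalMeasure_mono P h1 hA h2.le) (st_internalMeasure_mono P hA h1 h2.ge)

/-- `loebFun` as an additive content on the internal algebra. -/
def loebContent (U : Ultrafilter ι) (P : ∀ i, ProbabilityMeasure (X i)) :
    AddContent ℝ≥0∞ (internalAlgebra U X) :=
  isSetRing_internalAlgebra.addContent_of_union (loebFun P)
    (by
      rw [← internalSet_empty, loebFun_internalSet P fun _ => MeasurableSet.empty,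
        st_internalMeasure_empty, ENNReal.ofReal_zero])
    (by
      rintro _ _ ⟨A, hA, rfl⟩ ⟨B, hB, rfl⟩ hd
      have hBA : internalSet U B = internalSet U fun i => B i \ A i := by
        rw [internalSet_diff]; exact (hd.symm.sdiff_eq_left).symm
      have hU : internalSet U A ∪ internalSet U B = internalSet U fun i => A i ∪ (B i \ A i) := by
        rw [internalSet_union, hBA]
      rw [hU, hBA, loebFun_internalSet P fun i => (hA i).union ((hB i).diff (hA i)),
        loebFun_internalSet P hA, loebFun_internalSet P fun i => (hB i).diff (hA i),
        ← ENNReal.ofReal_add (st_internalMeasure_nonneg P _) (st_internalMeasure_nonneg P _)]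
      congr 1
      refine st_eq_of_tendsto ?_
      refine ((tendsto_internalMeasure P A).add (tendsto_internalMeasure P _)).congr fun i => ?_
      exact (measureReal_union Set.disjoint_sdiff_right ((hB i).diff (hA i))).symm)

theorem isSigmaSubadditive_loebContent : (loebContent U P).IsSigmaSubadditive := by
  intro f hf hfU
  choose B hB hBf using hf
  obtain ⟨A, hA, hAf⟩ := hfU
  change loebFun P _ ≤ ∑' n, loebFun P (f n)
  rw [← hAf, loebFun_internalSet P hA]
  simp_rw [← hBf, loebFun_internalSet P (hB _)]
  exact st_internalMeasure_le_tsum P A B hA hB (by rw [hAf]; simp [hBf])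

/-- The Loeb measure of the internal probability measure `[P i]`: the σ-additive extension of
`[A i] ↦ st (μ [A i])` to the σ-algebra generated by the internal algebra. -/
def loebMeasure (U : Ultrafilter ι) (P : ∀ i, ProbabilityMeasure (X i)) :
    Measure (UltraProd U X) :=
  (loebContent U P).measure isSetRing_internalAlgebra.isSetSemiring le_rfl
    (isSigmaSubadditive_loebContent P)

theorem loebMeasure_internalSet {A : ∀ i, Set (X i)} (hA : ∀ i, MeasurableSet (A i)) :
    loebMeasure U P (internalSet U A) = ENNReal.ofReal (st (internalMeasure P U A)) := by
  have hmem : internalSet U A ∈ internalAlgebra U X := ⟨A, hA, rfl⟩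
  rw [loebMeasure, AddContent.measure_eq _ _ rfl _ hmem]
  exact loebFun_internalSet P hA

instance isProbabilityMeasure_loebMeasure : IsProbabilityMeasure (loebMeasure U P) := by
  constructor
  have h : internalSet U (fun i => (Set.univ : Set (X i))) = Set.univ := by
    ext x
    induction x using ind with
    | h x => simp [mk_mem_internalSet]
  rw [← h, loebMeasure_internalSet P fun _ => MeasurableSet.univ,
    st_internalMeasure_univ, ENNReal.ofReal_one]

end UltraProd

/-! ### Internal Hilbert spaces -/

namespace UltraProd

section Algebra

variable {ι : Type*} {U : Ultrafilter ι} {E : ι → Type*}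

theorem mk_surjective : Function.Surjective (mk U : (∀ i, E i) → UltraProd U E) :=
  ind fun x => ⟨x, rfl⟩

variable [∀ i, NormedAddCommGroup (E i)]

instance : Zero (UltraProd U E) := ⟨mk U 0⟩

instance : Add (UltraProd U E) :=
  ⟨Quotient.map₂ (· + ·) fun _ _ h _ _ h2 => by filter_upwards [h, h2] with i hi hi2; simp [hi, hi2]⟩

instance : Neg (UltraProd U E) :=
  ⟨Quotient.map (- ·) fun _ _ h => by filter_upwards [h] with i hi; simp [hi]⟩

instance : Sub (UltraProd U E) :=
  ⟨Quotient.map₂ (· - ·) fun _ _ h _ _ h2 => by filter_upwards [h, h2] with i hi hi2; simp [hi, hi2]⟩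

instance : SMul ℕ (UltraProd U E) :=
  ⟨fun n => Quotient.map (n • ·) fun _ _ h => by filter_upwards [h] with i hi; simp [hi]⟩

instance : SMul ℤ (UltraProd U E) :=
  ⟨fun n => Quotient.map (n • ·) fun _ _ h => by filter_upwards [h] with i hi; simp [hi]⟩

instance : AddCommGroup (UltraProd U E) :=
  Function.Surjective.addCommGroup (mk U) mk_surjective rfl (fun _ _ => rfl) (fun _ => rfl)
    (fun _ _ => rfl) (fun _ _ => rfl) (fun _ _ => rfl)

theorem mk_add (x y : ∀ i, E i) : mk U (x + y) = mk U x + mk U y := rfl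

theorem mk_sub (x y : ∀ i, E i) : mk U (x - y) = mk U x - mk U y := rfl

/-- The internal norm, with hyperreal values. -/
def inorm (x : UltraProd U E) : Hyper U ℝ := map (fun _ v => ‖v‖) x

theorem inorm_mk (x : ∀ i, E i) : inorm (mk U x) = ((fun i => ‖x i‖ : ι → ℝ) : Hyper U ℝ) := rfl

variable [∀ i, InnerProductSpace ℂ (E i)]

/-- Internal scalar multiplication by hypercomplex numbers. -/
instance : SMul (Hyper U ℂ) (UltraProd U E) :=
  ⟨Quotient.map₂ (fun c x i => c i • x i) fun _ _ h _ _ h2 => by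
    filter_upwards [h, h2] with i hi hi2; simp [hi, hi2]⟩

theorem coe_smul_mk (c : ι → ℂ) (x : ∀ i, E i) :
    (c : Hyper U ℂ) • mk U x = mk U fun i => c i • x i := rfl

instance : Module (Hyper U ℂ) (UltraProd U E) where
  one_smul x := by
    induction x using ind with
    | h x => exact congrArg (mk U) (funext fun i => one_smul ℂ (x i))
  mul_smul a b x := by
    induction a using Germ.inductionOn with
    | h a => induction b using Germ.inductionOn with
      | h b => induction x using ind with
        | h x => exact congrArg (mk U) (funext fun i => mul_smul (a i) (b i) (x i))
  smul_zero a := by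
    induction a using Germ.inductionOn with
    | h a => exact congrArg (mk U) (funext fun i => smul_zero (a i))
  smul_add a x y := by
    induction a using Germ.inductionOn with
    | h a => induction x using ind with
      | h x => induction y using ind with
        | h y => exact congrArg (mk U) (funext fun i => smul_add (a i) (x i) (y i))
  add_smul a b x := by
    induction a using Germ.inductionOn with
    | h a => induction b using Germ.inductionOn with
      | h b => induction x using ind with
        | h x => exact congrArg (mk U) (funext fun i => add_smul (a i) (b i) (x i))
  zero_smul x := by
    induction x using ind with
    | h x => exact congrArg (mk U) (funext fun i => zero_smul ℂ (x i))

/-- Multiplication by standard complex numbers. -/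
instance : SMul ℂ (UltraProd U E) := ⟨fun c x => (Germ.const c : Hyper U ℂ) • x⟩

theorem const_smul_def (c : ℂ) (x : UltraProd U E) : c • x = (Germ.const c : Hyper U ℂ) • x := rfl

theorem smul_mk (c : ℂ) (x : ∀ i, E i) : c • mk U x = mk U (c • x) := rfl

instance : Module ℂ (UltraProd U E) where
  one_smul x := one_smul (Hyper U ℂ) x
  mul_smul a b x := mul_smul (Germ.const a : Hyper U ℂ) (Germ.const b) x
  smul_zero a := smul_zero (Germ.const a : Hyper U ℂ)
  smul_add a x y := smul_add (Germ.const a : Hyper U ℂ) x y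
  add_smul a b x := add_smul (Germ.const a : Hyper U ℂ) (Germ.const b) x
  zero_smul x := zero_smul (Hyper U ℂ) x

/-- The internal inner product, with hypercomplex values. -/
def iinner (x y : UltraProd U E) : Hyper U ℂ :=
  Quotient.liftOn₂ x y (fun x y => ((fun i => inner ℂ (x i) (y i) : ι → ℂ) : Hyper U ℂ))
    fun _ _ _ _ h h2 => Germ.coe_eq.2 (by filter_upwards [h, h2] with i hi hi2; simp [hi, hi2])

theorem iinner_mk (x y : ∀ i, E i) :
    iinner (mk U x) (mk U y) = ((fun i => inner ℂ (x i) (y i) : ι → ℂ) : Hyper U ℂ) := rfl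

/-- The internal linear operator `[T i]` given by a family of linear operators. -/
def internalOp (U : Ultrafilter ι) (T : ∀ i, E i →ₗ[ℂ] E i) :
    UltraProd U E →ₗ[Hyper U ℂ] UltraProd U E where
  toFun := Quotient.map (fun x i => T i (x i)) fun _ _ h => by
    filter_upwards [h] with i hi; simp [hi]
  map_add' x y := by
    induction x using ind with
    | h x => induction y using ind with
      | h y => exact congrArg (mk U) (funext fun i => map_add (T i) (x i) (y i))
  map_smul' c x := by
    induction c using Germ.inductionOn with
    | h c => induction x using ind with
      | h x => exact congrArg (mk U) (funext fun i => map_smul (T i) (c i) (x i))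

theorem internalOp_mk (T : ∀ i, E i →ₗ[ℂ] E i) (x : ∀ i, E i) :
    internalOp U T (mk U x) = mk U fun i => T i (x i) := rfl

end Algebra

end UltraProd

/-! ### Nonstandard hulls -/

section Hull

open UltraProd

variable {ι : Type*} {U : Ultrafilter ι} {E : ι → Type*} [∀ i, NormedAddCommGroup (E i)]

theorem isFinite_inorm_mk {x : ∀ i, E i} :
    IsFinite (inorm (mk U x)) ↔ ∃ C : ℝ, ∀ᶠ i in U, ‖x i‖ ≤ C := by
  rw [inorm_mk, isFinite_coe]
  simp

variable [∀ i, InnerProductSpace ℂ (E i)]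

/-- `fin(H)`: the vectors of finite norm. -/
def fin (U : Ultrafilter ι) (E : ι → Type*) [∀ i, NormedAddCommGroup (E i)]
    [∀ i, InnerProductSpace ℂ (E i)] : Submodule ℂ (UltraProd U E) where
  carrier := {x | IsFinite (inorm x)}
  zero_mem' := isFinite_inorm_mk.2 ⟨0, by simp⟩
  add_mem' {x y} hx hy := by
    induction x using ind with
    | h x => induction y using ind with
      | h y =>
        obtain ⟨C, hC⟩ := isFinite_inorm_mk.1 hx
        obtain ⟨D, hD⟩ := isFinite_inorm_mk.1 hy
        refine isFinite_inorm_mk.2 ⟨C + D, ?_⟩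
        filter_upwards [hC, hD] with i h1 h2
        exact (norm_add_le _ _).trans (add_le_add h1 h2)
  smul_mem' c x hx := by
    induction x using ind with
    | h x =>
      obtain ⟨C, hC⟩ := isFinite_inorm_mk.1 hx
      refine isFinite_inorm_mk.2 ⟨‖c‖ * C, ?_⟩
      filter_upwards [hC] with i h1
      exact (norm_smul_le c (x i)).trans (mul_le_mul_of_nonneg_left h1 (norm_nonneg c))

theorem mem_fin {x : UltraProd U E} : x ∈ fin U E ↔ IsFinite (inorm x) := Iff.rfl

theorem fin_ind {p : fin U E → Prop}
    (h : ∀ (x : ∀ i, E i) (hx : mk U x ∈ fin U E), p ⟨mk U x, hx⟩) (x : fin U E) : p x := by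
  obtain ⟨x, hx⟩ := x
  induction x using ind with
  | h x => exact h x hx

theorem tendsto_norm {x : ∀ i, E i} (hx : mk U x ∈ fin U E) :
    Tendsto (fun i => ‖x i‖) U (𝓝 (st (inorm (mk U x)))) := tendsto_st hx

theorem tendsto_inner {x y : ∀ i, E i} (hx : mk U x ∈ fin U E) (hy : mk U y ∈ fin U E) :
    Tendsto (fun i => inner ℂ (x i) (y i)) U (𝓝 (stC (iinner (mk U x) (mk U y)))) := by
  obtain ⟨C, hC⟩ := isFinite_inorm_mk.1 hx
  obtain ⟨D, hD⟩ := isFinite_inorm_mk.1 hy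
  have hb : ∀ᶠ i in U, ‖inner ℂ (x i) (y i)‖ ≤ C * D := by
    filter_upwards [hC, hD] with i h1 h2
    exact (norm_inner_le_norm _ _).trans
      (mul_le_mul h1 h2 (norm_nonneg _) ((norm_nonneg _).trans h1))
  have hre := tendsto_st (U := U) (f := fun i => (inner ℂ (x i) (y i)).re) (isFinite_coe.2
    ⟨C * D, hb.mono fun i hi => (Complex.abs_re_le_norm _).trans hi⟩)
  have him := tendsto_st (U := U) (f := fun i => (inner ℂ (x i) (y i)).im) (isFinite_coe.2
    ⟨C * D, hb.mono fun i hi => (Complex.abs_im_le_norm _).trans hi⟩)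
  have := (Complex.continuous_ofReal.tendsto _).comp hre |>.add
    (((Complex.continuous_ofReal.tendsto _).comp him).mul_const Complex.I)
  have hval : stC (iinner (mk U x) (mk U y)) =
      (st (((fun i => (inner ℂ (x i) (y i)).re : ι → ℝ)) : Hyper U ℝ) : ℂ) +
      (st (((fun i => (inner ℂ (x i) (y i)).im : ι → ℝ)) : Hyper U ℝ) : ℂ) * Complex.I :=
    Complex.mk_eq_add_mul_I _ _
  rw [hval]
  refine this.congr fun i => ?_
  exact Complex.re_add_im _

/-- The seminorm `st ‖φ‖` on `fin(H)`. -/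
def finSeminorm (U : Ultrafilter ι) (E : ι → Type*) [∀ i, NormedAddCommGroup (E i)]
    [∀ i, InnerProductSpace ℂ (E i)] : AddGroupSeminorm (fin U E) where
  toFun x := st (inorm (x : UltraProd U E))
  map_zero' := st_eq_of_tendsto (by simp)
  add_le' x y := by
    induction x using fin_ind with
    | h x hx => induction y using fin_ind with
      | h y hy =>
        exact le_of_tendsto_of_tendsto (tendsto_norm ((fin U E).add_mem hx hy))
          ((tendsto_norm hx).add (tendsto_norm hy))
          (Eventually.of_forall fun i => norm_add_le (x i) (y i))
  neg' x := by
    induction x using fin_ind with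
    | h x hx => exact st_eq_of_tendsto ((tendsto_norm hx).congr fun i => (norm_neg (x i)).symm)

instance : SeminormedAddCommGroup (fin U E) := (finSeminorm U E).toSeminormedAddCommGroup

theorem fin_norm_def (x : fin U E) : ‖x‖ = st (inorm (x : UltraProd U E)) := rfl

/-- The semi-inner product `st ⟨φ|ψ⟩` on `fin(H)`. -/
instance : InnerProductSpace ℂ (fin U E) where
  norm_smul_le c x := by
    induction x using fin_ind with
    | h x hx =>
      refine le_of_eq (st_eq_of_tendsto ?_)
      exact ((tendsto_norm hx).const_mul ‖c‖).congr fun i => (norm_smul c (x i)).symm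
  inner x y := stC (iinner (x : UltraProd U E) (y : UltraProd U E))
  norm_sq_eq_re_inner x := by
    induction x using fin_ind with
    | h x hx =>
      refine tendsto_nhds_unique ((tendsto_norm hx).pow 2) ?_
      refine ((Complex.continuous_re.tendsto _).comp (tendsto_inner hx hx)).congr fun i => ?_
      exact (norm_sq_eq_re_inner (𝕜 := ℂ) (x i)).symm
  conj_inner_symm x y := by
    induction x using fin_ind with
    | h x hx => induction y using fin_ind with
      | h y hy =>
        refine tendsto_nhds_unique ?_ (tendsto_inner hx hy)
        exact ((Complex.continuous_conj.tendsto _).comp (tendsto_inner hy hx)).congr fun i =>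
          inner_conj_symm (x i) (y i)
  add_left x y z := by
    induction x using fin_ind with
    | h x hx => induction y using fin_ind with
      | h y hy => induction z using fin_ind with
        | h z hz =>
          refine tendsto_nhds_unique (tendsto_inner ((fin U E).add_mem hx hy) hz) ?_
          exact ((tendsto_inner hx hz).add (tendsto_inner hy hz)).congr fun i =>
            (inner_add_left (x i) (y i) (z i)).symm
  smul_left x y c := by
    induction x using fin_ind with
    | h x hx => induction y using fin_ind with
      | h y hy =>
        refine tendsto_nhds_unique (tendsto_inner ((fin U E).smul_mem c hx) hy) ?_
        exact ((tendsto_inner hx hy).const_mul _).congr fun i =>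
          (inner_smul_left (x i) (y i) c).symm

theorem fin_inner_def (x y : fin U E) :
    inner ℂ x y = stC (iinner (x : UltraProd U E) (y : UltraProd U E)) := rfl

/-- The nonstandard hull `fin(H)/mon(H)`: finite vectors modulo vectors of infinitesimal norm. -/
abbrev Hull (U : Ultrafilter ι) (E : ι → Type*) [∀ i, NormedAddCommGroup (E i)]
    [∀ i, InnerProductSpace ℂ (E i)] : Type _ := SeparationQuotient (fin U E)

/-- The class `°φ` of a finite vector in the hull. -/
def toHull (x : UltraProd U E) (hx : x ∈ fin U E) : Hull U E := SeparationQuotient.mk ⟨x, hx⟩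

theorem toHull_eq_toHull {x y : UltraProd U E} (hx : x ∈ fin U E) (hy : y ∈ fin U E) :
    toHull x hx = toHull y hy ↔ InfClose (inorm (x - y)) (Germ.const 0) := by
  rw [toHull, toHull, SeparationQuotient.mk_eq_mk, Metric.inseparable_iff, dist_eq_norm,
    fin_norm_def]
  induction x using ind with
  | h x => induction y using ind with
    | h y =>
      have hxy := (fin U E).sub_mem hx hy
      have ht := tendsto_norm hxy
      change st (inorm (mk U x - mk U y)) = 0 ↔ _
      constructor
      · intro h0
        have := infClose_const_st hxy
        rwa [h0] at this
      · intro h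
        refine tendsto_nhds_unique ht (Metric.tendsto_nhds.2 fun ε hε => ?_)
        have h2 := infClose_coe.1 h ε hε
        exact h2.mono fun i hi => by simpa [Real.dist_eq] using hi

theorem norm_toHull (x : UltraProd U E) (hx : x ∈ fin U E) : ‖toHull x hx‖ = st (inorm x) := rfl

theorem inner_toHull (x y : UltraProd U E) (hx : x ∈ fin U E) (hy : y ∈ fin U E) :
    inner ℂ (toHull x hx) (toHull y hy) = stC (iinner x y) := rfl

/-- The hull is a Hilbert space: absolutely convergent series converge. -/
instance instCompleteSpaceHull [∀ i, CompleteSpace (E i)] : CompleteSpace (Hull U E) := by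
  refine NormedAddCommGroup.completeSpace_of_summable_imp_tendsto fun u hu => ?_
  have hrep : ∀ n, ∃ (x : ∀ i, E i) (hx : mk U x ∈ fin U E), toHull (mk U x) hx = u n := by
    intro n
    obtain ⟨v, hv⟩ := SeparationQuotient.surjective_mk (u n)
    induction v using fin_ind with
    | h x hx => exact ⟨x, hx, hv⟩
  choose x hx hxu using hrep
  let c : ℕ → ℝ := fun n => ‖u n‖ + (1 / 2) ^ n
  have hc : Summable c := hu.add summable_geometric_two
  classical
  let y : ℕ → ∀ i, E i := fun n i => if ‖x n i‖ ≤ c n then x n i else 0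
  have hyc : ∀ n i, ‖y n i‖ ≤ c n := by
    intro n i
    by_cases h : ‖x n i‖ ≤ c n
    · simpa only [y, if_pos h] using h
    · simp only [y, if_neg h, norm_zero]
      positivity
  have hyx : ∀ n, mk U (y n) = mk U (x n) := by
    intro n
    have hlt : st (inorm (mk U (x n))) < c n := by
      rw [← norm_toHull _ (hx n), hxu n]
      exact lt_add_of_pos_right _ (by positivity)
    refine mk_eq_mk.2 (((tendsto_norm (hx n)).eventually (gt_mem_nhds hlt)).mono fun i hi => ?_)
    exact if_pos (le_of_lt hi)
  have hyf : ∀ n, mk U (y n) ∈ fin U E := fun n => by rw [hyx n]; exact hx n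
  have hsum : ∀ i, Summable fun n => y n i := fun i =>
    Summable.of_norm_bounded hc fun n => hyc n i
  have hsf : mk U (fun i => ∑' n, y n i) ∈ fin U E :=
    isFinite_inorm_mk.2 ⟨∑' n, c n, Eventually.of_forall fun i =>
      tsum_of_norm_bounded hc.hasSum fun n => hyc n i⟩
  refine ⟨toHull _ hsf, ?_⟩
  have hpart : ∀ N, ∃ hN : mk U (fun i => ∑ n ∈ Finset.range N, y n i) ∈ fin U E,
      toHull _ hN = ∑ n ∈ Finset.range N, u n := by
    intro N
    induction N with
    | zero => exact ⟨(fin U E).zero_mem, rfl⟩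
    | succ N ih =>
      obtain ⟨h1, h2⟩ := ih
      have h3 : mk U (fun i => ∑ n ∈ Finset.range (N + 1), y n i) =
          mk U (fun i => ∑ n ∈ Finset.range N, y n i) + mk U (y N) :=
        congrArg (mk U) (funext fun i => Finset.sum_range_succ _ _)
      have h4 : toHull (mk U (y N)) (hyf N) = u N := by
        rw [← hxu N]
        congr 1
        exact hyx N
      rw [Finset.sum_range_succ, ← h2, ← h4]
      have h5 : mk U (fun i => ∑ n ∈ Finset.range (N + 1), y n i) ∈ fin U E :=
        h3 ▸ (fin U E).add_mem h1 (hyf N)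
      have h6 : (⟨_, h5⟩ : fin U E) = ⟨_, h1⟩ + ⟨_, hyf N⟩ := Subtype.ext h3
      exact ⟨h5, congrArg SeparationQuotient.mk h6⟩
  rw [tendsto_iff_norm_sub_tendsto_zero]
  have htail : Tendsto (fun N => ∑' n, c (n + N)) atTop (𝓝 0) := tendsto_sum_nat_add c
  refine squeeze_zero (fun _ => norm_nonneg _) (fun N => ?_) htail
  obtain ⟨h1, h2⟩ := hpart N
  rw [← h2, norm_sub_rev]
  refine le_of_tendsto (tendsto_norm ((fin U E).sub_mem hsf h1)) (Eventually.of_forall fun i => ?_)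
  have h3 := (hsum i).sum_add_tsum_nat_add N
  have h4 : (∑' n, y n i) - ∑ n ∈ Finset.range N, y n i = ∑' n, y (n + N) i := by
    rw [← h3]; abel
  change ‖(∑' n, y n i) - ∑ n ∈ Finset.range N, y n i‖ ≤ _
  rw [h4]
  exact tsum_of_norm_bounded ((summable_nat_add_iff N).2 hc).hasSum fun n => hyc (n + N) i

/-- An operator on an internal Hilbert space is finitely bounded if some standard real bounds
its operator norm. -/
def FinitelyBounded (B : UltraProd U E →ₗ[Hyper U ℂ] UltraProd U E) : Prop :=
  ∃ C : ℝ, ∀ x, inorm (B x) ≤ (Germ.const C : Hyper U ℝ) * inorm x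

theorem FinitelyBounded.exists_bound {B : UltraProd U E →ₗ[Hyper U ℂ] UltraProd U E}
    (hB : FinitelyBounded B) : ∃ C : ℝ, ∀ x (hx : x ∈ fin U E),
      ∃ hBx : B x ∈ fin U E, ‖(⟨B x, hBx⟩ : fin U E)‖ ≤ C * ‖(⟨x, hx⟩ : fin U E)‖ := by
  obtain ⟨C, hC⟩ := hB
  refine ⟨C, fun x hx => ?_⟩
  have h1 := hC x
  have h2 : ∃ y : ∀ i, E i, mk U y = B x := mk_surjective (B x)
  obtain ⟨y, hy⟩ := h2
  simp only [fin_norm_def]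
  rw [← hy] at h1 ⊢
  induction x using ind with
  | h x =>
    have h3 : ∀ᶠ i in U, ‖y i‖ ≤ C * ‖x i‖ := h1
    obtain ⟨D, hD⟩ := isFinite_inorm_mk.1 hx
    have hyf : mk U y ∈ fin U E := isFinite_inorm_mk.2 ⟨|C| * D, by
      filter_upwards [h3, hD] with i h4 h5
      exact h4.trans ((mul_le_mul_of_nonneg_right (le_abs_self C) (norm_nonneg _)).trans
        (mul_le_mul_of_nonneg_left h5 (abs_nonneg C)))⟩
    exact ⟨hyf, le_of_tendsto_of_tendsto (tendsto_norm hyf) ((tendsto_norm hx).const_mul C) h3⟩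

theorem FinitelyBounded.map_fin {B : UltraProd U E →ₗ[Hyper U ℂ] UltraProd U E}
    (hB : FinitelyBounded B) {x : UltraProd U E} (hx : x ∈ fin U E) : B x ∈ fin U E :=
  let ⟨_, h⟩ := hB.exists_bound
  (h x hx).1

/-- The restriction of a finitely bounded operator to `fin(H)`. -/
def finOp (B : UltraProd U E →ₗ[Hyper U ℂ] UltraProd U E) (hB : FinitelyBounded B) :
    fin U E →L[ℂ] fin U E :=
  LinearMap.mkContinuousOfExistsBound
    { toFun := fun x => ⟨B x, hB.map_fin x.2⟩
      map_add' := fun x y => Subtype.ext (map_add B (x : UltraProd U E) y)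
      map_smul' := fun c x => Subtype.ext
        (map_smul B (Germ.const c : Hyper U ℂ) (x : UltraProd U E)) }
    (let ⟨C, h⟩ := hB.exists_bound; ⟨C, fun x => (h x x.2).2⟩)

/-- The nonstandard hull `°B` of a finitely bounded operator, `°B °φ = °(B φ)`. -/
def hullOp (B : UltraProd U E →ₗ[Hyper U ℂ] UltraProd U E) (hB : FinitelyBounded B) :
    Hull U E →L[ℂ] Hull U E :=
  SeparationQuotient.liftCLM ((SeparationQuotient.mkCLM ℂ (fin U E)).comp (finOp B hB))
    fun _ _ h => SeparationQuotient.mk_eq_mk.2 (h.map (finOp B hB).continuous)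

theorem hullOp_toHull (B : UltraProd U E →ₗ[Hyper U ℂ] UltraProd U E) (hB : FinitelyBounded B)
    (x : UltraProd U E) (hx : x ∈ fin U E) :
    hullOp B hB (toHull x hx) = toHull (B x) (hB.map_fin hx) := rfl

/-- The hull of an internally self-adjoint operator is self-adjoint. -/
theorem isSelfAdjoint_hullOp [∀ i, CompleteSpace (E i)]
    (B : UltraProd U E →ₗ[Hyper U ℂ] UltraProd U E) (hB : FinitelyBounded B)
    (hs : ∀ x y, iinner (B x) y = iinner x (B y)) : IsSelfAdjoint (hullOp B hB) := by
  rw [ContinuousLinearMap.isSelfAdjoint_iff_isSymmetric]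
  intro x y
  obtain ⟨⟨x, hx⟩, rfl⟩ := SeparationQuotient.surjective_mk x
  obtain ⟨⟨y, hy⟩, rfl⟩ := SeparationQuotient.surjective_mk y
  exact congrArg stC (hs x y)

end Hull

/-! ### Scalar-valued spectral measures -/

section Spectral

variable {H : Type*} [NormedAddCommGroup H] [InnerProductSpace ℂ H] [CompleteSpace H]

/-- The positive functional `f ↦ ⟨v, f(T) v⟩` on `C_c(ℝ)`, given by the continuous functional
calculus of the bounded self-adjoint operator `T`. -/
def spectralFunctional (T : H →L[ℂ] H) (v : H) :
    CompactlySupportedContinuousMap ℝ ℝ →ₚ[ℝ] ℝ :=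
  PositiveLinearMap.mk₀
    { toFun := fun f => (inner ℂ v (cfc (f : ℝ → ℝ) T v)).re
      map_add' := fun f g => by
        have h : cfc (⇑(f + g)) T = cfc (⇑f) T + cfc (⇑g) T :=
          cfc_add (R := ℝ) T f g f.continuous.continuousOn g.continuous.continuousOn
        rw [h, add_apply, inner_add_right, Complex.add_re]
      map_smul' := fun r f => by
        have h : cfc (⇑(r • f)) T = r • cfc (⇑f) T :=
          cfc_smul (R := ℝ) r f T f.continuous.continuousOn
        rw [h, smul_apply, inner_smul_right_eq_smul]
        simp }
    fun f hf => by
      have h : 0 ≤ cfc (⇑f) T := cfc_nonneg fun x _ => hf x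
      rw [ContinuousLinearMap.nonneg_iff_isPositive] at h
      have h2 := h.re_inner_nonneg_right v
      exact h2

/-- The scalar-valued spectral measure of the bounded self-adjoint operator `T` at `v`: the Borel
measure `ν` on `ℝ` with `∫ f dν = ⟨v, f(T) v⟩`. -/
def spectralMeasure (T : H →L[ℂ] H) (_hT : IsSelfAdjoint T) (v : H) : Measure ℝ :=
  RealRMK.rieszMeasure (spectralFunctional T v)

theorem integral_spectralMeasure (T : H →L[ℂ] H) (hT : IsSelfAdjoint T) (v : H)
    (f : CompactlySupportedContinuousMap ℝ ℝ) :
    ∫ x, f x ∂(spectralMeasure T hT v) = (inner ℂ v (cfc (f : ℝ → ℝ) T v)).re :=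
  RealRMK.integral_rieszMeasure _ f

end Spectral

/-! ### Repeated spin measurements

For a standard number `n` of measurements, branches are functions `Fin n → Bool`, where `true`
stands for spin up. The objects for a hypernatural number `K = [k i]` of measurements are the
ultraproducts of those for `k i`. -/

open UltraProd

/-- The `n`-fold tensor product of `ℂ²` with orthonormal basis `|x⟩`, `x : Fin n → Bool`. -/
abbrev SpinSpace (n : ℕ) : Type := EuclideanSpace ℂ (Fin n → Bool)

/-- The basis vector `|x⟩`. -/
def ket {n : ℕ} (x : Fin n → Bool) : SpinSpace n := EuclideanSpace.single x 1

/-- The identification of the `n`-fold tensor product of `ℂ²` with `SpinSpace n`. -/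
def tensorEquiv (n : ℕ) :
    PiTensorProduct ℂ (fun _ : Fin n => EuclideanSpace ℂ Bool) ≃ₗ[ℂ] SpinSpace n :=
  (Basis.piTensorProduct fun _ : Fin n => (EuclideanSpace.basisFun Bool ℂ).toBasis).equivFun ≪≫ₗ
    (WithLp.linearEquiv 2 ℂ ((Fin n → Bool) → ℂ)).symm

theorem tensorEquiv_tprod (n : ℕ) (v : Fin n → EuclideanSpace ℂ Bool) (x : Fin n → Bool) :
    tensorEquiv n (PiTensorProduct.tprod ℂ v) x = ∏ j, v j (x j) := by
  refine (Basis.piTensorProduct_repr_tprod_apply _ v x).trans ?_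
  simp

theorem inner_tensorEquiv_tprod (n : ℕ) (v w : Fin n → EuclideanSpace ℂ Bool) :
    inner ℂ (tensorEquiv n (PiTensorProduct.tprod ℂ v)) (tensorEquiv n (PiTensorProduct.tprod ℂ w))
      = ∏ j, inner ℂ (v j) (w j) := by
  simp only [PiLp.inner_apply, tensorEquiv_tprod]
  rw [Finset.prod_univ_sum, Fintype.piFinset_univ]
  refine Finset.sum_congr rfl fun x _ => ?_
  simp [RCLike.inner_apply, Finset.prod_mul_distrib]

/-- The number of spin-up results in a branch. -/
def upCount {n : ℕ} (x : Fin n → Bool) : ℕ := (Finset.univ.filter fun j => x j = true).card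

/-- The relative frequency of spin up in a branch. -/
def relFreq {n : ℕ} (x : Fin n → Bool) : ℝ := upCount x / n

/-- The amplitude of the branch `x`. -/
def amplitude (α β : ℂ) {n : ℕ} (x : Fin n → Bool) : ℂ := α ^ upCount x * β ^ (n - upCount x)

/-- The state `∑ x, α ^ i_x * β ^ (n - i_x) |x⟩`. -/
def spinState (α β : ℂ) (n : ℕ) : SpinSpace n := ∑ x, amplitude α β x • ket x

/-- The relative frequency operator, `|x⟩ ↦ λ_x |x⟩`. -/
def freqOp (n : ℕ) : SpinSpace n →ₗ[ℂ] SpinSpace n :=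
  (EuclideanSpace.basisFun (Fin n → Bool) ℂ).toBasis.constr ℂ fun x => (relFreq x : ℂ) • ket x

theorem spinState_apply (α β : ℂ) (n : ℕ) (x : Fin n → Bool) :
    spinState α β n x = amplitude α β x := by
  simp [spinState, ket, Finset.sum_apply, Pi.single_apply]

theorem freqOp_ket {n : ℕ} (x : Fin n → Bool) : freqOp n (ket x) = (relFreq x : ℂ) • ket x := by
  have h : ket x = (EuclideanSpace.basisFun (Fin n → Bool) ℂ).toBasis x := by simp [ket]
  rw [freqOp, h, Module.Basis.constr_basis, ← h]

theorem freqOp_apply {n : ℕ} (v : SpinSpace n) (x : Fin n → Bool) :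
    freqOp n v x = relFreq x * v x := by
  rw [freqOp, Module.Basis.constr_apply_fintype]
  simp [ket, Finset.sum_apply, Pi.single_apply, mul_comm]

theorem upCount_le {n : ℕ} (x : Fin n → Bool) : upCount x ≤ n :=
  (Finset.card_filter_le (Finset.univ : Finset (Fin n)) fun j => x j = true).trans
    (Finset.card_fin n).le

theorem relFreq_mem {n : ℕ} (x : Fin n → Bool) : 0 ≤ relFreq x ∧ relFreq x ≤ 1 :=
  ⟨by unfold relFreq; positivity,
    div_le_one_of_le₀ (Nat.cast_le.2 (upCount_le x)) (Nat.cast_nonneg n)⟩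

theorem amplitude_eq_prod (α β : ℂ) {n : ℕ} (x : Fin n → Bool) :
    amplitude α β x = ∏ j, bif x j then α else β := by
  have h : ∀ j, (bif x j then α else β) = if x j = true then α else β := fun j => by
    cases x j <;> rfl
  have hc := Finset.card_filter_add_card_filter_not (s := (Finset.univ : Finset (Fin n)))
    (fun j => x j = true)
  rw [Finset.card_fin] at hc
  simp only [h]
  rw [Finset.prod_ite, Finset.prod_const, Finset.prod_const, amplitude, upCount]
  congr 2
  omega

/-- The state is the tensor product of `n` copies of `α |↑⟩ + β |↓⟩`. -/
theorem spinState_eq_tensorEquiv (α β : ℂ) (n : ℕ) :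
    spinState α β n = tensorEquiv n (PiTensorProduct.tprod ℂ fun _ =>
      α • EuclideanSpace.single true 1 + β • EuclideanSpace.single false 1) := by
  ext x
  rw [spinState_apply, amplitude_eq_prod, tensorEquiv_tprod]
  refine Finset.prod_congr rfl fun j _ => ?_
  cases x j <;> simp

theorem sum_norm_amplitude_sq {α β : ℂ} (h : ‖α‖ ^ 2 + ‖β‖ ^ 2 = 1) (n : ℕ) :
    ∑ x : Fin n → Bool, ‖amplitude α β x‖ ^ 2 = 1 := by
  have h2 : ∀ x : Fin n → Bool, ‖amplitude α β x‖ ^ 2 =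
      ∏ j, bif x j then ‖α‖ ^ 2 else ‖β‖ ^ 2 := by
    intro x
    rw [amplitude_eq_prod, norm_prod, ← Finset.prod_pow]
    refine Finset.prod_congr rfl fun j _ => ?_
    cases x j <;> rfl
  simp only [h2]
  have h3 := Finset.prod_univ_sum (fun _ : Fin n => (Finset.univ : Finset Bool))
    (fun _ b => bif b then ‖α‖ ^ 2 else ‖β‖ ^ 2)
  rw [Fintype.piFinset_univ] at h3
  rw [← h3]
  simp [h]

theorem norm_spinState {α β : ℂ} (h : ‖α‖ ^ 2 + ‖β‖ ^ 2 = 1) (n : ℕ) : ‖spinState α β n‖ = 1 := by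
  rw [EuclideanSpace.norm_eq]
  simp only [spinState_apply, sum_norm_amplitude_sq h, Real.sqrt_one]

theorem norm_freqOp_le {n : ℕ} (v : SpinSpace n) : ‖freqOp n v‖ ≤ ‖v‖ := by
  rw [EuclideanSpace.norm_eq, EuclideanSpace.norm_eq]
  refine Real.sqrt_le_sqrt (Finset.sum_le_sum fun x _ => ?_)
  rw [freqOp_apply, norm_mul, Complex.norm_real, Real.norm_of_nonneg (relFreq_mem x).1]
  exact pow_le_pow_left₀ (mul_nonneg (relFreq_mem x).1 (norm_nonneg _))
    (mul_le_of_le_one_left (norm_nonneg _) (relFreq_mem x).2) 2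

theorem inner_freqOp {n : ℕ} (v w : SpinSpace n) :
    inner ℂ (freqOp n v) w = inner ℂ v (freqOp n w) := by
  simp only [PiLp.inner_apply, freqOp_apply, RCLike.inner_apply, map_mul, Complex.conj_ofReal]
  exact Finset.sum_congr rfl fun x _ => by ring

/-- The norm-squared measure on the `2 ^ n` branches. -/
def branchMeasure (α β : ℂ) (h : ‖α‖ ^ 2 + ‖β‖ ^ 2 = 1) (n : ℕ) :
    ProbabilityMeasure (Fin n → Bool) :=
  ⟨∑ x, ENNReal.ofReal (‖amplitude α β x‖ ^ 2) • Measure.dirac x, by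
    constructor
    rw [Measure.finsetSum_apply]
    simp only [Measure.smul_apply, measure_univ, smul_eq_mul, mul_one]
    rw [← ENNReal.ofReal_sum_of_nonneg fun _ _ => sq_nonneg _, sum_norm_amplitude_sq h,
      ENNReal.ofReal_one]⟩

/-- The scalar-valued spectral measure of the relative frequency operator at the state:
`E ↦ ∑ |α ^ i_x * β ^ (n - i_x)|²` over the `x` with `λ_x ∈ E`. -/
def freqMeasure (α β : ℂ) (h : ‖α‖ ^ 2 + ‖β‖ ^ 2 = 1) (n : ℕ) : ProbabilityMeasure ℝ :=
  ⟨∑ x : Fin n → Bool, ENNReal.ofReal (‖amplitude α β x‖ ^ 2) • Measure.dirac (relFreq x), by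
    constructor
    rw [Measure.finsetSum_apply]
    simp only [Measure.smul_apply, measure_univ, smul_eq_mul, mul_one]
    rw [← ENNReal.ofReal_sum_of_nonneg fun _ _ => sq_nonneg _, sum_norm_amplitude_sq h,
      ENNReal.ofReal_one]⟩

section Hyperfinite

variable {ι : Type*} (U : Ultrafilter ι) (k : ι → ℕ)

/-- The internal tensor product of `K = [k i]` copies of `*ℂ²`. -/
abbrev HyperSpinSpace : Type _ := UltraProd U fun i => SpinSpace (k i)

/-- The hyperfinite set `2^K` of branches. -/
abbrev HyperBranch : Type _ := UltraProd U fun i => (Fin (k i) → Bool)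

/-- The relative frequency `λ_x = i_x / K` of a branch `x ∈ 2^K`. -/
def hyperFreq (x : HyperBranch U k) : Hyper U ℝ := UltraProd.map (fun _ y => relFreq y) x

theorem hyperFreq_eq (x : HyperBranch U k) : hyperFreq U k x =
    (UltraProd.map (fun _ y => upCount y) x).map (Nat.cast : ℕ → ℝ) /
      (k : Hyper U ℕ).map (Nat.cast : ℕ → ℝ) := by
  induction x using UltraProd.ind with
  | h x => rfl

/-- The state `|ψ⟩ = ∑ x ∈ 2^K, α ^ i_x * β ^ (K - i_x) |x⟩`. -/
def hyperState (α β : ℂ) : HyperSpinSpace U k := mk U fun i => spinState α β (k i)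

/-- The internal relative frequency operator `B |x⟩ = λ_x |x⟩`. -/
def hyperFreqOp : HyperSpinSpace U k →ₗ[Hyper U ℂ] HyperSpinSpace U k :=
  internalOp U fun i => freqOp (k i)

theorem finitelyBounded_hyperFreqOp : FinitelyBounded (hyperFreqOp U k) := by
  refine ⟨1, fun x => ?_⟩
  induction x using UltraProd.ind with
  | h x => exact Eventually.of_forall fun i => (norm_freqOp_le (x i)).trans (one_mul _).ge

theorem hyperFreqOp_symmetric (x y : HyperSpinSpace U k) :
    iinner (hyperFreqOp U k x) y = iinner x (hyperFreqOp U k y) := by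
  induction x using UltraProd.ind with
  | h x => induction y using UltraProd.ind with
    | h y => exact Germ.coe_eq.2 (Eventually.of_forall fun i => inner_freqOp (x i) (y i))

theorem hyperState_mem_fin {α β : ℂ} (h : ‖α‖ ^ 2 + ‖β‖ ^ 2 = 1) :
    hyperState U k α β ∈ fin U fun i => SpinSpace (k i) :=
  isFinite_inorm_mk.2 ⟨1, Eventually.of_forall fun i => (norm_spinState h (k i)).le⟩

/-- The hull `°B` of the relative frequency operator. -/
def hullFreqOp : Hull U (fun i => SpinSpace (k i)) →L[ℂ] Hull U (fun i => SpinSpace (k i)) :=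
  hullOp (hyperFreqOp U k) (finitelyBounded_hyperFreqOp U k)

theorem isSelfAdjoint_hullFreqOp : IsSelfAdjoint (hullFreqOp U k) :=
  isSelfAdjoint_hullOp _ _ (hyperFreqOp_symmetric U k)

/-- The vector `°|ψ⟩` of the hull. -/
def hullState (α β : ℂ) (h : ‖α‖ ^ 2 + ‖β‖ ^ 2 = 1) : Hull U (fun i => SpinSpace (k i)) :=
  toHull (hyperState U k α β) (hyperState_mem_fin U k h)

/-- The Loeb measure of the internal norm-squared measure on the branches `2^K`. -/
def branchLoeb (α β : ℂ) (h : ‖α‖ ^ 2 + ‖β‖ ^ 2 = 1) : Measure (HyperBranch U k) :=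
  loebMeasure U fun i => branchMeasure α β h (k i)

/-- A point of the ultrapower of `ℝ`, as a hyperreal number. -/
def toHyper (r : UltraProd U fun _ : ι => ℝ) : Hyper U ℝ := UltraProd.map (fun _ t => t) r

/-- The Loeb measure of the internal scalar-valued spectral measure, living on `*ℝ`. -/
def freqLoeb (α β : ℂ) (h : ‖α‖ ^ 2 + ‖β‖ ^ 2 = 1) : Measure (UltraProd U fun _ : ι => ℝ) :=
  loebMeasure U fun i => freqMeasure α β h (k i)

end Hyperfinite

end Nonstandard

end

open Nonstandard

/-!
For `n` standard measurements the number of spin-up results is binomially distributed under the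
norm-squared measure, with success probability `‖α‖ ^ 2`. The relative frequency therefore has
mean `‖α‖ ^ 2` and variance `‖α‖ ^ 2 * ‖β‖ ^ 2 / n ≤ 1 / n`
(`sum_norm_amplitude_sq_mul_sub_sq`, deduced from the variance of the Bernstein polynomials).
When the number of measurements is infinite, the variance is infinitesimal, and this is used twice.

* By Chebyshev's inequality, the relative frequency deviates from `‖α‖ ^ 2` by a standard `ε > 0`
  only with infinitesimal probability. The complement of the set `λ ≈ ‖α‖ ^ 2` is a countable union
  of such internal sets, so it is Loeb measurable and null (`loebMeasure_infClose_map`). This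
  applies to `2^K`, and to `*ℝ` because the internal spectral measure is the distribution of the
  relative frequency.
* The variance is also the squared norm of `B ψ - ‖α‖ ^ 2 • ψ`. This vector is thus infinitesimal,
  so its class in the hull vanishes (`hullFreqOp_hullState`), while `°ψ` is a unit vector. Hence
  `°ψ` is an eigenvector. The continuous functional calculus acts on it by evaluation at the
  eigenvalue, so its spectral measure is a point mass (`spectralMeasure_eq_dirac`).
-/

/-! ### The weak law of large numbers for branches -/

namespace Nonstandard

/-- A sum over branches of a function of the number of spin-up results, grouped by that number. -/
theorem sum_upCount {M : Type*} [AddCommMonoid M] (n : ℕ) (f : ℕ → M) :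
    ∑ x : Fin n → Bool, f (upCount x) = ∑ m ∈ Finset.range (n + 1), n.choose m • f m := by
  have h := Finset.sum_powerset_apply_card f (x := (Finset.univ : Finset (Fin n)))
  rw [Finset.card_fin] at h
  rw [← h]
  refine Finset.sum_nbij' (fun x => Finset.univ.filter fun j => x j = true)
    (fun s j => decide (j ∈ s)) ?_ ?_ ?_ ?_ ?_ <;> simp [upCount]

theorem norm_amplitude_sq (α β : ℂ) {n : ℕ} (x : Fin n → Bool) :
    ‖amplitude α β x‖ ^ 2 = (‖α‖ ^ 2) ^ upCount x * (‖β‖ ^ 2) ^ (n - upCount x) := by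
  rw [amplitude, norm_mul, norm_pow, norm_pow, mul_pow, pow_right_comm, pow_right_comm ‖β‖]

/-- The variance of the relative frequency of spin up in the norm-squared measure. -/
theorem sum_norm_amplitude_sq_mul_sub_sq {α β : ℂ} (h : ‖α‖ ^ 2 + ‖β‖ ^ 2 = 1) {n : ℕ}
    (hn : n ≠ 0) :
    ∑ x : Fin n → Bool, ‖amplitude α β x‖ ^ 2 * (relFreq x - ‖α‖ ^ 2) ^ 2 =
      ‖α‖ ^ 2 * ‖β‖ ^ 2 / n := by
  have hβ : ‖β‖ ^ 2 = 1 - ‖α‖ ^ 2 := by linarith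
  have hn' : (n : ℝ) ≠ 0 := Nat.cast_ne_zero.2 hn
  have hB := congrArg (Polynomial.eval (‖α‖ ^ 2)) (bernsteinPolynomial.variance ℝ n)
  simp only [norm_amplitude_sq, relFreq, hβ]
  rw [sum_upCount n fun m => (‖α‖ ^ 2) ^ m * (1 - ‖α‖ ^ 2) ^ (n - m) *
    ((m : ℝ) / n - ‖α‖ ^ 2) ^ 2]
  simp only [Polynomial.eval_finsetSum, bernsteinPolynomial, nsmul_eq_mul, Polynomial.eval_mul,
    Polynomial.eval_pow, Polynomial.eval_sub, Polynomial.eval_natCast, Polynomial.eval_X,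
    Polynomial.eval_one] at hB
  rw [eq_div_iff hn', ← mul_left_inj' hn', mul_assoc, Finset.sum_mul,
    show ‖α‖ ^ 2 * (1 - ‖α‖ ^ 2) * n = n * ‖α‖ ^ 2 * (1 - ‖α‖ ^ 2) by ring, ← hB]
  refine Finset.sum_congr rfl fun m _ => ?_
  have hm : (n : ℝ) * ‖α‖ ^ 2 - m = -(n * (m / n - ‖α‖ ^ 2)) := by
    rw [mul_sub, mul_div_cancel₀ _ hn', neg_sub]
  rw [hm]
  ring

theorem sum_norm_amplitude_sq_mul_sub_sq_le {α β : ℂ} (h : ‖α‖ ^ 2 + ‖β‖ ^ 2 = 1) {n : ℕ}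
    (hn : n ≠ 0) :
    ∑ x : Fin n → Bool, ‖amplitude α β x‖ ^ 2 * (relFreq x - ‖α‖ ^ 2) ^ 2 ≤ 1 / n := by
  rw [sum_norm_amplitude_sq_mul_sub_sq h hn]
  gcongr
  nlinarith [sq_nonneg ‖α‖, sq_nonneg ‖β‖]

/-- The operator form of the variance estimate: the state is an approximate eigenvector of the
relative frequency operator. -/
theorem norm_freqOp_spinState_sub_sq_le {α β : ℂ} (h : ‖α‖ ^ 2 + ‖β‖ ^ 2 = 1) {n : ℕ}
    (hn : n ≠ 0) :
    ‖freqOp n (spinState α β n) - ((‖α‖ ^ 2 : ℝ) : ℂ) • spinState α β n‖ ^ 2 ≤ 1 / n := by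
  refine le_of_eq_of_le ?_ (sum_norm_amplitude_sq_mul_sub_sq_le h hn)
  rw [EuclideanSpace.norm_sq_eq]
  refine Finset.sum_congr rfl fun x _ => ?_
  rw [PiLp.sub_apply, PiLp.smul_apply, freqOp_apply, spinState_apply, smul_eq_mul, ← sub_mul,
    ← Complex.ofReal_sub, norm_mul, Complex.norm_real, mul_pow, Real.norm_eq_abs, sq_abs, mul_comm]

theorem measurable_relFreq (n : ℕ) : Measurable (relFreq : (Fin n → Bool) → ℝ) :=
  measurable_of_finite _

/-- The spectral measure of the relative frequency operator is the distribution of the relative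
frequency. -/
theorem freqMeasure_eq_map (α β : ℂ) (h : ‖α‖ ^ 2 + ‖β‖ ^ 2 = 1) (n : ℕ) :
    (freqMeasure α β h n : Measure ℝ) =
      (branchMeasure α β h n : Measure (Fin n → Bool)).map relFreq := by
  change _ = Measure.map relFreq (∑ x, ENNReal.ofReal (‖amplitude α β x‖ ^ 2) • Measure.dirac x)
  rw [Measure.map_finset_sum (measurable_relFreq n).aemeasurable]
  refine Finset.sum_congr rfl fun x _ => ?_
  rw [Measure.map_smul, Measure.map_dirac' (measurable_relFreq n)]

theorem lintegral_branchMeasure (α β : ℂ) (h : ‖α‖ ^ 2 + ‖β‖ ^ 2 = 1) {n : ℕ}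
    (f : (Fin n → Bool) → ℝ≥0∞) :
    ∫⁻ x, f x ∂(branchMeasure α β h n : Measure (Fin n → Bool)) =
      ∑ x, ENNReal.ofReal (‖amplitude α β x‖ ^ 2) * f x := by
  change ∫⁻ x, f x ∂(∑ x, ENNReal.ofReal (‖amplitude α β x‖ ^ 2) • Measure.dirac x) = _
  simp [lintegral_finsetSum_measure]

/-- Chebyshev's inequality for the relative frequency of spin up. -/
theorem branchMeasure_real_le {α β : ℂ} (h : ‖α‖ ^ 2 + ‖β‖ ^ 2 = 1) {n : ℕ} (hn : n ≠ 0)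
    {ε : ℝ} (hε : 0 < ε) :
    (branchMeasure α β h n : Measure (Fin n → Bool)).real {x | ε ≤ |relFreq x - ‖α‖ ^ 2|} ≤
      1 / n / ε ^ 2 := by
  have hset : {x : Fin n → Bool | ε ≤ |relFreq x - ‖α‖ ^ 2|} =
      {x | ENNReal.ofReal (ε ^ 2) ≤ ENNReal.ofReal ((relFreq x - ‖α‖ ^ 2) ^ 2)} := by
    ext x
    simp only [Set.mem_ofPred_eq]
    rw [ENNReal.ofReal_le_ofReal_iff (sq_nonneg _), sq_le_sq, abs_of_pos hε]
  have hM := mul_meas_ge_le_lintegral (μ := (branchMeasure α β h n : Measure (Fin n → Bool)))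
    (measurable_of_finite fun x => ENNReal.ofReal ((relFreq x - ‖α‖ ^ 2) ^ 2))
    (ENNReal.ofReal (ε ^ 2))
  rw [← hset, lintegral_branchMeasure] at hM
  simp only [← ENNReal.ofReal_mul (sq_nonneg _)] at hM
  rw [← ENNReal.ofReal_sum_of_nonneg fun _ _ => by positivity] at hM
  have h2 := ENNReal.toReal_le_of_le_ofReal (by positivity)
    (hM.trans (ENNReal.ofReal_le_ofReal (sum_norm_amplitude_sq_mul_sub_sq_le h hn)))
  rw [ENNReal.toReal_mul, ENNReal.toReal_ofReal (sq_nonneg ε)] at h2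
  rw [le_div_iff₀ (by positivity), mul_comm]
  exact h2

/-! ### Concentration and Loeb measure -/

section Loeb

open UltraProd

variable {ι : Type*} {U : Ultrafilter ι} {X : ι → Type*}

theorem setOf_infClose_map_eq_iInter (f : ∀ i, X i → ℝ) (c : ℝ) :
    {x : UltraProd U X | InfClose (UltraProd.map f x) (Germ.const c)} =
      ⋂ n : ℕ, (internalSet U fun i => {y | 1 / ((n : ℝ) + 1) ≤ |f i y - c|})ᶜ := by
  ext x
  induction x using UltraProd.ind with
  | h x =>
    simp only [Set.mem_ofPred_eq, Set.mem_iInter, Set.mem_compl_iff, mk_mem_internalSet, map_mk,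
      ← Ultrafilter.eventually_not, not_le]
    refine (infClose_coe (g := fun _ => c)).trans
      ⟨fun h n => h _ Nat.one_div_pos_of_nat, fun h ε hε => ?_⟩
    obtain ⟨n, hn⟩ := exists_nat_one_div_lt hε
    exact (h n).mono fun i hi => hi.trans hn

variable [∀ i, MeasurableSpace (X i)]

theorem measurableSet_internalSet {A : ∀ i, Set (X i)} (hA : ∀ i, MeasurableSet (A i)) :
    MeasurableSet (internalSet U A) :=
  MeasurableSpace.measurableSet_generateFrom ⟨A, hA, rfl⟩

theorem measurableSet_infClose_map {f : ∀ i, X i → ℝ} (hf : ∀ i, Measurable (f i)) (c : ℝ) :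
    MeasurableSet {x : UltraProd U X | InfClose (UltraProd.map f x) (Germ.const c)} := by
  rw [setOf_infClose_map_eq_iInter]
  exact MeasurableSet.iInter fun n => (measurableSet_internalSet fun i =>
    measurableSet_le measurable_const ((hf i).sub_const c).abs).compl

/-- If the internal random variable `f` converges in probability to the standard constant `c`
along the ultrafilter, then it is infinitely close to `c` Loeb almost surely. -/
theorem loebMeasure_infClose_map (P : ∀ i, ProbabilityMeasure (X i)) {f : ∀ i, X i → ℝ}
    (hf : ∀ i, Measurable (f i)) {c : ℝ}
    (h : ∀ ε : ℝ, 0 < ε →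
      Tendsto (fun i => (P i : Measure (X i)).real {y | ε ≤ |f i y - c|}) U (𝓝 0)) :
    loebMeasure U P {x | InfClose (UltraProd.map f x) (Germ.const c)} = 1 := by
  rw [← prob_compl_eq_zero_iff (measurableSet_infClose_map hf c), setOf_infClose_map_eq_iInter,
    Set.compl_iInter, measure_iUnion_null_iff]
  intro n
  rw [compl_compl, loebMeasure_internalSet P fun i =>
    measurableSet_le measurable_const ((hf i).sub_const c).abs]
  rw [show st (internalMeasure P U _) = 0 from st_eq_of_tendsto (h _ Nat.one_div_pos_of_nat),
    ENNReal.ofReal_zero]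

end Loeb

/-! ### Spectral measures at eigenvectors -/

section Spectral

variable {H : Type*} [NormedAddCommGroup H] [InnerProductSpace ℂ H]

theorem mem_spectrum_of_apply_eq_smul {T : H →L[ℂ] H} {v : H} {c : ℝ} (hv : v ≠ 0)
    (hTv : T v = c • v) : c ∈ spectrum ℝ T := by
  rintro ⟨u, hu⟩
  have h0 : (u : H →L[ℂ] H) v = 0 := by
    rw [hu, sub_apply, hTv, Algebra.algebraMap_eq_smul_one]
    simp
  refine hv ?_
  have h1 : (↑u⁻¹ : H →L[ℂ] H) ((u : H →L[ℂ] H) v) = v :=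
    congrArg (fun S : H →L[ℂ] H => S v) u.inv_mul
  rw [← h1, h0, map_zero]

variable [CompleteSpace H]

/-- The continuous functional calculus acts on an eigenvector by evaluation at the eigenvalue. -/
theorem cfc_apply_of_apply_eq_smul {T : H →L[ℂ] H} (hT : IsSelfAdjoint T) {v : H} {c : ℝ}
    (hv : v ≠ 0) (hTv : T v = c • v) {f : ℝ → ℝ} (hf : Continuous f) :
    cfc f T v = f c • v := by
  have hc := mem_spectrum_of_apply_eq_smul hv hTv
  have hid : cfcHom hT (.restrict (spectrum ℝ T) (.id ℝ)) v = c • v := by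
    rw [cfcHom_id hT, hTv]
  have key : ∀ g : C(spectrum ℝ T, ℝ), cfcHom hT g v = g ⟨c, hc⟩ • v := by
    intro g
    induction g using ContinuousMap.induction_on_of_compact with
    | const r =>
      change cfcHom hT (algebraMap ℝ C(spectrum ℝ T, ℝ) r) v = r • v
      rw [AlgHomClass.commutes, Algebra.algebraMap_eq_smul_one]
      simp
    | id => exact hid
    | star_id =>
      rw [star_trivial]
      exact hid
    | add f g hf hg => rw [map_add, add_apply, hf, hg, ← add_smul]; rfl
    | mul f g hf hg =>
      rw [map_mul, mul_apply_eq_comp, hg, ContinuousLinearMap.map_smul_of_tower, hf,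
        smul_smul, mul_comm]
      rfl
    | frequently f hfr =>
      have hcl : IsClosed {g : C(spectrum ℝ T, ℝ) | cfcHom hT g v = g ⟨c, hc⟩ • v} :=
        isClosed_eq ((ContinuousLinearMap.apply ℂ H v).continuous.comp (cfcHom_continuous hT))
          (Continuous.smul (f := fun g : C(spectrum ℝ T, ℝ) => g ⟨c, hc⟩)
            (continuous_eval_const _) continuous_const)
      exact hcl.mem_of_frequently_of_tendsto hfr tendsto_id
  rw [cfc_apply f T hT hf.continuousOn, key]
  rfl

/-- The spectral measure at a unit eigenvector is the point mass at the eigenvalue. -/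
theorem spectralMeasure_eq_dirac {T : H →L[ℂ] H} (hT : IsSelfAdjoint T) {v : H} {c : ℝ}
    (hv : ‖v‖ = 1) (hTv : T v = c • v) : spectralMeasure T hT v = Measure.dirac c := by
  have : (spectralMeasure T hT v).Regular := RealRMK.regular_rieszMeasure _
  refine Measure.ext_of_integral_eq_on_compactlySupported fun f => ?_
  have hv0 : v ≠ 0 := fun h0 => by simp [h0] at hv
  rw [integral_spectralMeasure, integral_dirac,
    cfc_apply_of_apply_eq_smul (f := f) hT hv0 hTv f.continuous, inner_smul_right_eq_smul,
    inner_self_eq_norm_sq_to_K, hv]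
  simp

end Spectral

/-! ### Infinitely many measurements -/

section Hyperfinite

open UltraProd

variable {ι : Type*} {U : Ultrafilter ι} {k : ι → ℕ} {α β : ℂ}

theorem tendsto_one_div_of_isInfiniteNat (hk : IsInfiniteNat (k : Hyper U ℕ)) :
    Tendsto (fun i => 1 / (k i : ℝ)) U (𝓝 0) := by
  have h : Tendsto k U atTop := tendsto_atTop.2 fun n => by
    have h2 : ∀ᶠ i in U, n < k i := Germ.coe_lt.1 (hk n)
    exact h2.mono fun i hi => hi.le
  exact tendsto_const_div_atTop_nhds_zero_nat 1 |>.comp h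

theorem eventually_ne_zero_of_isInfiniteNat (hk : IsInfiniteNat (k : Hyper U ℕ)) :
    ∀ᶠ i in U, k i ≠ 0 := by
  have h : ∀ᶠ i in U, 0 < k i := Germ.coe_lt.1 (hk 0)
  exact h.mono fun i hi => hi.ne'

theorem tendsto_branchMeasure_real (hk : IsInfiniteNat (k : Hyper U ℕ))
    (h : ‖α‖ ^ 2 + ‖β‖ ^ 2 = 1) {ε : ℝ} (hε : 0 < ε) :
    Tendsto (fun i => (branchMeasure α β h (k i) : Measure (Fin (k i) → Bool)).real
      {x | ε ≤ |relFreq x - ‖α‖ ^ 2|}) U (𝓝 0) := by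
  have h0 := (tendsto_one_div_of_isInfiniteNat hk).div_const (ε ^ 2)
  rw [zero_div] at h0
  exact squeeze_zero' (Eventually.of_forall fun _ => measureReal_nonneg)
    ((eventually_ne_zero_of_isInfiniteNat hk).mono fun i hi => branchMeasure_real_le h hi hε) h0

theorem branchLoeb_infClose (hk : IsInfiniteNat (k : Hyper U ℕ)) (h : ‖α‖ ^ 2 + ‖β‖ ^ 2 = 1) :
    branchLoeb U k α β h {x | InfClose (hyperFreq U k x) (Germ.const (‖α‖ ^ 2))} = 1 :=
  loebMeasure_infClose_map _ (fun i => measurable_relFreq (k i)) fun _ hε =>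
    tendsto_branchMeasure_real hk h hε

theorem freqLoeb_infClose (hk : IsInfiniteNat (k : Hyper U ℕ)) (h : ‖α‖ ^ 2 + ‖β‖ ^ 2 = 1) :
    freqLoeb U k α β h {r | InfClose (toHyper U r) (Germ.const (‖α‖ ^ 2))} = 1 := by
  refine loebMeasure_infClose_map _ (fun _ => measurable_id) fun ε hε =>
    (tendsto_branchMeasure_real hk h hε).congr fun i => ?_
  rw [freqMeasure_eq_map, map_measureReal_apply (measurable_relFreq (k i))
    (measurableSet_le measurable_const (measurable_id.sub_const _).abs)]
  rfl

theorem norm_hullState (h : ‖α‖ ^ 2 + ‖β‖ ^ 2 = 1) : ‖hullState U k α β h‖ = 1 :=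
  st_eq_of_tendsto (by simp only [norm_spinState h]; exact tendsto_const_nhds)

theorem hullFreqOp_hullState (hk : IsInfiniteNat (k : Hyper U ℕ)) (h : ‖α‖ ^ 2 + ‖β‖ ^ 2 = 1) :
    hullFreqOp U k (hullState U k α β h) = ((‖α‖ ^ 2 : ℝ) : ℂ) • hullState U k α β h := by
  have hsmul : ((‖α‖ ^ 2 : ℝ) : ℂ) • hullState U k α β h =
      toHull (((‖α‖ ^ 2 : ℝ) : ℂ) • hyperState U k α β)
        ((fin U _).smul_mem _ (hyperState_mem_fin U k h)) := rfl
  rw [hsmul, hullState, hullFreqOp, hullOp_toHull, toHull_eq_toHull]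
  refine infClose_coe (f := fun i => ‖freqOp (k i) (spinState α β (k i)) -
    ((‖α‖ ^ 2 : ℝ) : ℂ) • spinState α β (k i)‖) (g := fun _ => 0) |>.2 fun ε hε => ?_
  filter_upwards [eventually_ne_zero_of_isInfiniteNat hk,
    (tendsto_one_div_of_isInfiniteNat hk).eventually (gt_mem_nhds (pow_pos hε 2))] with i hi hlt
  rw [sub_zero, abs_norm]
  exact lt_of_pow_lt_pow_left₀ 2 hε.le ((norm_freqOp_spinState_sub_sq_le h hi).trans_lt hlt)

end Hyperfinite

end Nonstandard

theorem mainTheorem1 {ι : Type*} (U : Ultrafilter ι) (K : Hyper U ℕ) (hK : IsInfiniteNat K)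
    (k : ι → ℕ) (hk : (k : Hyper U ℕ) = K)
    (α β : ℂ) (h : ‖α‖ ^ 2 + ‖β‖ ^ 2 = 1) :
    (MeasurableSet {x : HyperBranch U k |
          InfClose (hyperFreq U k x) (Germ.const (‖α‖ ^ 2))} ∧
      branchLoeb U k α β h {x : HyperBranch U k |
          InfClose (hyperFreq U k x) (Germ.const (‖α‖ ^ 2))} = 1) ∧
    (MeasurableSet {r : UltraProd U fun _ : ι => ℝ |
          InfClose (toHyper U r) (Germ.const (‖α‖ ^ 2))} ∧
      freqLoeb U k α β h {r : UltraProd U fun _ : ι => ℝ |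
          InfClose (toHyper U r) (Germ.const (‖α‖ ^ 2))} = 1) ∧
    spectralMeasure (hullFreqOp U k) (isSelfAdjoint_hullFreqOp U k) (hullState U k α β h)
        {‖α‖ ^ 2} = 1 ∧
    Module.End.HasEigenvector
      (hullFreqOp U k : Hull U (fun i => SpinSpace (k i)) →ₗ[ℂ] Hull U (fun i => SpinSpace (k i)))
      ((‖α‖ ^ 2 : ℝ) : ℂ) (hullState U k α β h) := by
  subst hk
  have hT := hullFreqOp_hullState hK h
  refine ⟨⟨measurableSet_infClose_map (fun i => measurable_relFreq (k i)) _,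
    branchLoeb_infClose hK h⟩, ⟨measurableSet_infClose_map (fun _ => measurable_id) _,
    freqLoeb_infClose hK h⟩, ?_, Module.End.hasEigenvector_iff.2 ⟨Module.End.mem_eigenspace_iff.2 hT,
    fun h0 => ?_⟩⟩
  · rw [spectralMeasure_eq_dirac _ (norm_hullState h) hT]
    exact Measure.dirac_apply_of_mem (Set.mem_singleton _)
  · have h1 := norm_hullState (U := U) (k := k) h
    rw [h0, norm_zero] at h1
    exact zero_ne_one h1
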